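/- **LF-type error bound via LF-case PFDBT.** Let $G(s)=C(sI-A)^{-1}B+D$ be a continuous-time linear system with $A\in\mathbb C^{n\times n}$, $B\in\mathbb C^{n\times m}$, $C\in\mathbb C^{p\times n}$, $D\in\mathbb C^{p\times m}$ (real matrices are a special case). Let $\varpi_l>0$, $\rho\in\mathbb R$, $\kappa=(\rho^2+\varpi_l^2)^{1/2}$ and $0\le r\le n$. Define two discrete-time mapped systems. * Upper type (needs $\rho I-A$ invertible), with $N=(\rho I-A)^{-1}$: $\hat A=\kappa N$, $\hat B=NB$, $\hat C=CN$, $\hat D=\kappa^{-1}(CNB+D)$. * Lower type (needs $A$ invertible), with $N=(-A)^{-1}$: $\check A=\kappa^{-1}\varpi_l N\bigl(\varpi_l I-\tfrac{\rho}{\varpi_l}A\bigr)$, $\check B=\kappa^{-1}\varpi_l NB$, $\check C=\kappa^{-1}\varpi_l CN$, $\check D=\kappa^{-1}(CNB+D)$. The parameter $\rho$ is *admissible* for a type if the mapped system of that type exists and its state matrix is Schur stable (all eigenvalues in the open unit disc). *Standard discrete-time Lyapunov balanced truncation* of a Schur stable system $(\mathbf A,\mathbf B,\mathbf C,\mathbf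 D)$ to order $r$: solve $\mathbf AP\mathbf A^*-P+\mathbf B\mathbf B^*=0$ and $\mathbf A^*Q\mathbf A-Q+\mathbf C^*\mathbf C=0$; factor $P=UU^*$ with $U$ invertible; write $U^*QU=V\Sigma^2V^*$ with $V$ unitary and $\Sigma$ diagonal with positive, decreasingly ordered entries; put $T=\Sigma^{1/2}V^*U^{-1}$; in $(T\mathbf AT^{-1},T\mathbf B,\mathbf CT^{-1},\mathbf D)$ keep the first $r$ states. The *Hankel singular values* of the system are the square roots of the eigenvalues of $PQ$, with multiplicity, in decreasing order. The *LF-case PFDBT algorithm* chooses a type for which $\rho$ is admissible, applies this truncation to the mapped system of $G$ of that type, and maps the reduced system $(A',B',C',D')$ back by the inverse mapping, giving $G_r$ with realization $(A_r,B_r,C_r,D_r)$: * Upper type (needs $A'$ invertible): $A_r=\rho I-\kappa A'^{-1}$, $B_r=(\rho I-A_r)B'$, $C_r=C'(\rho I-A_r)$, $D_r=\kappa D'-C_r(\rho I-A_r)^{-1}B_r$. * Lower type (needs $\rho I-\kappa A'$ invertible): $A_r=\varpi_l^2(\rho I-\kappa A')^{-1}$, $B_r=-\tfrac{\kappa}{\varpi_l}A_rB'$,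 $C_r=-\tfrac{\kappa}{\varpi_l}C'A_r$, $D_r=\kappa D'-C_r(-A_r)^{-1}B_r$. Theorem. Suppose $G_r(s)=C_r(sI-A_r)^{-1}B_r+D_r$ is an order-$r$ model of $G$ produced by this algorithm, with either type, and let $\sigma_{l1}\ge\dots\ge\sigma_{ln}$ be the Hankel singular values of the mapped system of that type. Then for every $\omega\in[-\varpi_l,\varpi_l]$ the matrices $j\omega I-A$ and $j\omega I-A_r$ are invertible and $$\sigma_{\max}\bigl(G(j\omega)-G_r(j\omega)\bigr)\le 2(\rho^2+\varpi_l^2)^{1/2}\sum_{i=r+1}^n\sigma_{li}.$$ -/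

import Mathlib

open scoped Matrix

namespace PFDBT

/-- A state-space realization `(A, B, C, D)` of order `n` with `m` inputs and `p` outputs.
Real matrices are the special case of matrices with real entries. -/
structure Realization (n m p : ℕ) where
  A : Matrix (Fin n) (Fin n) ℂ
  B : Matrix (Fin n) (Fin m) ℂ
  C : Matrix (Fin p) (Fin n) ℂ
  D : Matrix (Fin p) (Fin m) ℂ

/-- The transfer function `s ↦ C (s I - A)⁻¹ B + D` (meaningful where `s I - A` is invertible). -/
noncomputable def Realization.transfer {n m p : ℕ} (S : Realization n m p) (s : ℂ) :
    Matrix (Fin p) (Fin m) ℂ :=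
  S.C * (s • (1 : Matrix (Fin n) (Fin n) ℂ) - S.A)⁻¹ * S.B + S.D

open scoped Matrix.Norms.L2Operator in
/-- The maximum singular value of a matrix, i.e. its operator norm with respect to the Euclidean
norms. -/
noncomputable def sigmaMax {p m : ℕ} (M : Matrix (Fin p) (Fin m) ℂ) : ℝ := ‖M‖

/-- Schur stability: all eigenvalues lie in the open unit disc. -/
def IsSchurStable {n : ℕ} (A : Matrix (Fin n) (Fin n) ℂ) : Prop :=
  ∀ μ ∈ spectrum ℂ A, ‖μ‖ < 1

/-! ### Discrete-time Lyapunov balanced truncation -/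

/-- `P` solves the discrete-time controllability Lyapunov equation. -/
def Realization.IsControllabilityGramian {n m p : ℕ} (S : Realization n m p)
    (P : Matrix (Fin n) (Fin n) ℂ) : Prop :=
  S.A * P * S.Aᴴ - P + S.B * S.Bᴴ = 0

/-- `Q` solves the discrete-time observability Lyapunov equation. -/
def Realization.IsObservabilityGramian {n m p : ℕ} (S : Realization n m p)
    (Q : Matrix (Fin n) (Fin n) ℂ) : Prop :=
  S.Aᴴ * Q * S.A - Q + S.Cᴴ * S.C = 0

/-- `σ` lists the Hankel singular values of the discrete-time system `S` in decreasing order: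
the square roots of the eigenvalues of `P Q`, with algebraic multiplicity. (If `S.A` is Schur
stable, the Gramians `P` and `Q` exist and are unique.) -/
def Realization.IsHankelSingularValues {n m p : ℕ} (S : Realization n m p) (σ : Fin n → ℝ) :
    Prop :=
  Antitone σ ∧ (∀ i, 0 ≤ σ i) ∧
    ∃ P Q : Matrix (Fin n) (Fin n) ℂ,
      S.IsControllabilityGramian P ∧ S.IsObservabilityGramian Q ∧
      (P * Q).charpoly = ∏ i, (Polynomial.X - Polynomial.C (((σ i : ℝ) : ℂ) ^ 2))

/-- The change of state coordinates `x ↦ T x`. -/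
noncomputable def Realization.changeCoords {n m p : ℕ} (S : Realization n m p)
    (T : Matrix (Fin n) (Fin n) ℂ) : Realization n m p where
  A := T * S.A * T⁻¹
  B := T * S.B
  C := S.C * T⁻¹
  D := S.D

/-- Keep the first `r` states. -/
def Realization.truncate {n m p : ℕ} (S : Realization n m p) (r : ℕ) (hr : r ≤ n) :
    Realization r m p where
  A := S.A.submatrix (Fin.castLE hr) (Fin.castLE hr)
  B := S.B.submatrix (Fin.castLE hr) id
  C := S.C.submatrix id (Fin.castLE hr)
  D := S.D

/-- `R` is an order-`r` reduced model of `S` produced by standard discrete-time Lyapunov balanced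
truncation: solve the Lyapunov equations for `P` and `Q`; factor `P = U Uᴴ` with `U` invertible
(for instance a Cholesky factor); diagonalize `Uᴴ Q U = V Σ² Vᴴ` with `V` unitary and `Σ` diagonal
with positive decreasing entries; put `T = Σ^(1/2) Vᴴ U⁻¹`; pass to the coordinates `T x`, in which
both Gramians are equal to `Σ`; and truncate. -/
def Realization.IsBalancedTruncation {n m p : ℕ} (S : Realization n m p) (r : ℕ) (hr : r ≤ n)
    (R : Realization r m p) : Prop :=
  ∃ (P Q U V : Matrix (Fin n) (Fin n) ℂ) (s : Fin n → ℝ),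
    S.IsControllabilityGramian P ∧ S.IsObservabilityGramian Q ∧
    IsUnit U.det ∧ P = U * Uᴴ ∧
    V ∈ Matrix.unitaryGroup (Fin n) ℂ ∧ Antitone s ∧ (∀ i, 0 < s i) ∧
    Uᴴ * Q * U = V * Matrix.diagonal (fun i => ((s i : ℝ) : ℂ) ^ 2) * Vᴴ ∧
    R = (S.changeCoords
      (Matrix.diagonal (fun i => ((Real.sqrt (s i) : ℝ) : ℂ)) * Vᴴ * U⁻¹)).truncate r hr

/-! ### Parameterized frequency-dependent mappings for the band `[-w, w]` -/

/-- `(ρ² + w²)^(1/2)`. -/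
noncomputable def gain (ρ w : ℝ) : ℝ := Real.sqrt (ρ ^ 2 + w ^ 2)

/-- The upper type mapping. -/
noncomputable def Realization.upperMap {n m p : ℕ} (S : Realization n m p) (ρ w : ℝ) :
    Realization n m p :=
  let N : Matrix (Fin n) (Fin n) ℂ := ((ρ : ℂ) • (1 : Matrix (Fin n) (Fin n) ℂ) - S.A)⁻¹
  { A := (gain ρ w : ℂ) • N
    B := N * S.B
    C := S.C * N
    D := (gain ρ w : ℂ)⁻¹ • (S.C * N * S.B + S.D) }

/-- The lower type mapping. -/
noncomputable def Realization.lowerMap {n m p : ℕ} (S : Realization n m p) (ρ w : ℝ) :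
    Realization n m p :=
  let N : Matrix (Fin n) (Fin n) ℂ := (-S.A)⁻¹
  { A := ((gain ρ w : ℂ)⁻¹ * (w : ℂ)) •
      (N * ((w : ℂ) • (1 : Matrix (Fin n) (Fin n) ℂ) + ((ρ : ℂ) / (w : ℂ)) • (-S.A)))
    B := ((gain ρ w : ℂ)⁻¹ * (w : ℂ)) • (N * S.B)
    C := ((gain ρ w : ℂ)⁻¹ * (w : ℂ)) • (S.C * N)
    D := (gain ρ w : ℂ)⁻¹ • (S.C * N * S.B) + (gain ρ w : ℂ)⁻¹ • S.D }

/-- The inverse of the upper type mapping, defined for systems `R` with `R.A` invertible. -/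
noncomputable def Realization.upperInv {n m p : ℕ} (R : Realization n m p) (ρ w : ℝ) :
    Realization n m p :=
  let A' : Matrix (Fin n) (Fin n) ℂ :=
    (ρ : ℂ) • (1 : Matrix (Fin n) (Fin n) ℂ) - (gain ρ w : ℂ) • R.A⁻¹
  let E : Matrix (Fin n) (Fin n) ℂ := (ρ : ℂ) • (1 : Matrix (Fin n) (Fin n) ℂ) - A'
  { A := A'
    B := E * R.B
    C := R.C * E
    D := (gain ρ w : ℂ) • R.D - (R.C * E) * E⁻¹ * (E * R.B) }

/-- The inverse of the lower type mapping, defined for systems `R` with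
`ρ I - (ρ² + w²)^(1/2) R.A` invertible. -/
noncomputable def Realization.lowerInv {n m p : ℕ} (R : Realization n m p) (ρ w : ℝ) :
    Realization n m p :=
  let A' : Matrix (Fin n) (Fin n) ℂ :=
    ((w : ℂ) ^ 2) • ((ρ : ℂ) • (1 : Matrix (Fin n) (Fin n) ℂ) - (gain ρ w : ℂ) • R.A)⁻¹
  let B' : Matrix (Fin n) (Fin m) ℂ := ((gain ρ w : ℂ) / (w : ℂ)) • (-A' * R.B)
  let C' : Matrix (Fin p) (Fin n) ℂ := ((gain ρ w : ℂ) / (w : ℂ)) • (R.C * -A')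
  { A := A'
    B := B'
    C := C'
    D := (gain ρ w : ℂ) • R.D - C' * (-A')⁻¹ * B' }

/-! ### The low-frequency PFDBT algorithm -/

/-- The two routings of the algorithm. -/
inductive Routing where
  | upper
  | lower

/-- The discrete-time mapped system used by a routing. -/
noncomputable def Routing.mapped {n m p : ℕ} (k : Routing) (S : Realization n m p) (ρ w : ℝ) :
    Realization n m p :=
  match k with
  | .upper => S.upperMap ρ w
  | .lower => S.lowerMap ρ w

/-- The mapped system exists: the matrix inverted by the mapping is invertible. -/
def Routing.MapDefined {n m p : ℕ} (k : Routing) (S : Realization n m p) (ρ : ℝ) : Prop :=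
  match k with
  | .upper => IsUnit ((ρ : ℂ) • (1 : Matrix (Fin n) (Fin n) ℂ) - S.A).det
  | .lower => IsUnit S.A.det

/-- The continuous-time system obtained from `R` by the inverse mapping of a routing. -/
noncomputable def Routing.unmapped {n m p : ℕ} (k : Routing) (R : Realization n m p) (ρ w : ℝ) :
    Realization n m p :=
  match k with
  | .upper => R.upperInv ρ w
  | .lower => R.lowerInv ρ w

/-- The inverse mapping can be applied to `R`. -/
def Routing.InvDefined {n m p : ℕ} (k : Routing) (R : Realization n m p) (ρ w : ℝ) : Prop :=
  match k with
  | .upper => IsUnit R.A.det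
  | .lower => IsUnit ((ρ : ℂ) • (1 : Matrix (Fin n) (Fin n) ℂ) - (gain ρ w : ℂ) • R.A).det

/-- `ρ` is admissible: the mapped system exists and is Schur stable, so that standard discrete-time
balanced truncation applies to it. -/
def Routing.Admissible {n m p : ℕ} (k : Routing) (S : Realization n m p) (ρ w : ℝ) : Prop :=
  k.MapDefined S ρ ∧ IsSchurStable (k.mapped S ρ w).A

/-- `Gr` is an order-`r` output of the low-frequency PFDBT algorithm, routing `k`, for the system
`G`, the band `[-w, w]` and the admissible parameter `ρ`: map `G`, apply standard discrete-time
balanced truncation, and map back. -/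
def IsPFDBTReduction {n m p : ℕ} (k : Routing) (G : Realization n m p) (ρ w : ℝ) (r : ℕ)
    (hr : r ≤ n) (Gr : Realization r m p) : Prop :=
  k.Admissible G ρ w ∧
    ∃ R : Realization r m p,
      (k.mapped G ρ w).IsBalancedTruncation r hr R ∧ k.InvDefined R ρ w ∧
      Gr = k.unmapped R ρ w

end PFDBT

/-!
The mappings are Möbius substitutions. If the upper type mapping sends `G` to `Ĝ`, then
`G(s) = κ Ĝ(z)` with `z = κ / (ρ - s)`; for the lower type, `z = (ρ - w² / s) / κ`. Both send the
segment `s = jω`, `|ω| ≤ w`, into `1 ≤ ‖z‖ ≤ ∞` (`band_dichotomy`), and the inverse mappings really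
are inverse (`mapped_unmapped`), so the error at `jω` is `κ` times the error of discrete-time
balanced truncation at `z`. At `z = ∞` only the feedthrough matrices remain, and truncation keeps
them.

The discrete-time bound is proved by a dissipation argument valid at every `z` with `1 ≤ ‖z‖`, so
that no maximum principle is needed. In balanced coordinates the Gramian equations give two
inequalities, `IsDissipative`, which, unlike the Gramian equations, are inherited when states are
dropped. Hence states can be dropped one at a time. When the dropped state has weight `σ`, and `x`,
`y` are the states of the full and the reduced system for the same input `u` at frequency `z`, with
`x̂ = (y, 0)`, put
`V = ∑ sᵢ ‖(x - x̂)ᵢ‖² + σ² ∑ sᵢ⁻¹ ‖(x + x̂)ᵢ‖²`. The two inequalities and the parallelogram law in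
the dropped coordinate give `‖z‖² V + ‖output error‖² ≤ V + (2σ)² ‖u‖²`, so the error gain is at most
`2σ` (`output_error_dropLast`); summing gives `sigmaMax_transfer_sub_truncate_le`. The observability
inequality also shows that the reduced system has no eigenvalue with `1 ≤ ‖z‖`.

Finally, Schur stability makes the Gramians unique, so the diagonal weights found by the algorithm
are the Hankel singular values.
-/

open scoped Matrix

namespace PFDBT

open Complex

/-! ### The mappings and the frequency band -/

lemma gain_pos (ρ : ℝ) {w : ℝ} (hw : 0 < w) : 0 < gain ρ w :=
  Real.sqrt_pos.mpr (by positivity)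

section Mapping

variable {n m p : ℕ}

lemma upperMap_transfer (S : Realization n m p) {ρ w : ℝ} (hw : 0 < w)
    (hS : IsUnit ((ρ : ℂ) • (1 : Matrix (Fin n) (Fin n) ℂ) - S.A).det) {s : ℂ}
    (hs : (ρ : ℂ) - s ≠ 0)
    (hz : IsUnit (((gain ρ w : ℂ) / (ρ - s)) • (1 : Matrix (Fin n) (Fin n) ℂ)
      - (S.upperMap ρ w).A).det) :
    IsUnit (s • (1 : Matrix (Fin n) (Fin n) ℂ) - S.A).det ∧
      S.transfer s = (gain ρ w : ℂ) • (S.upperMap ρ w).transfer ((gain ρ w : ℂ) / (ρ - s)) := by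
  have hκ : (gain ρ w : ℂ) ≠ 0 := by exact_mod_cast (gain_pos ρ hw).ne'
  set κ : ℂ := (gain ρ w : ℂ) with hκd
  set E : Matrix (Fin n) (Fin n) ℂ := (ρ : ℂ) • (1 : Matrix (Fin n) (Fin n) ℂ) - S.A with hE
  set F : Matrix (Fin n) (Fin n) ℂ := s • (1 : Matrix (Fin n) (Fin n) ℂ) - S.A with hF
  have hNE : E⁻¹ * E = 1 := Matrix.nonsing_inv_mul _ hS
  have hEN : E * E⁻¹ = 1 := Matrix.mul_nonsing_inv _ hS
  have hEF : E = (ρ - s) • 1 + F := by rw [hE, hF, sub_smul]; abel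
  have hA : (κ / (ρ - s)) • (1 : Matrix (Fin n) (Fin n) ℂ) - (S.upperMap ρ w).A
      = (κ / (ρ - s)) • (E⁻¹ * F) := by
    have hF' : F = E - (ρ - s) • 1 := by rw [hEF]; abel
    rw [hF', mul_sub, hNE, smul_sub, mul_smul_comm, mul_one, smul_smul, div_mul_cancel₀ _ hs]
    rfl
  have hFu : IsUnit F.det := by
    rw [hA, Matrix.det_smul, Matrix.det_mul] at hz
    exact isUnit_of_mul_isUnit_right (isUnit_of_mul_isUnit_right hz)
  refine ⟨hFu, ?_⟩
  have hFF : F * F⁻¹ = 1 := Matrix.mul_nonsing_inv _ hFu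
  have hinv : ((κ / (ρ - s)) • (E⁻¹ * F))⁻¹ = ((ρ - s) / κ) • (F⁻¹ * E) := by
    refine Matrix.inv_eq_right_inv ?_
    rw [smul_mul_smul_comm, show E⁻¹ * F * (F⁻¹ * E) = E⁻¹ * (F * F⁻¹) * E by noncomm_ring, hFF,
      mul_one, hNE, show κ / (ρ - s) * ((ρ - s) / κ) = 1 by field_simp, one_smul]
  have key : F⁻¹ = (ρ - s) • (E⁻¹ * F⁻¹) + E⁻¹ := by
    calc F⁻¹ = E⁻¹ * E * F⁻¹ := by rw [hNE, one_mul]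
      _ = E⁻¹ * ((ρ - s) • 1 + F) * F⁻¹ := by rw [← hEF]
      _ = (ρ - s) • (E⁻¹ * F⁻¹) + E⁻¹ * (F * F⁻¹) := by
        simp only [mul_add, add_mul, mul_smul_comm, smul_mul_assoc, mul_one, mul_assoc]
      _ = _ := by rw [hFF, mul_one]
  unfold Realization.transfer
  rw [hA, hinv]
  change S.C * F⁻¹ * S.B + S.D = κ • (S.C * E⁻¹ * (((ρ - s) / κ) • (F⁻¹ * E)) * (E⁻¹ * S.B)
      + κ⁻¹ • (S.C * E⁻¹ * S.B + S.D))
  have h1 : S.C * E⁻¹ * (((ρ - s) / κ) • (F⁻¹ * E)) * (E⁻¹ * S.B)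
      = ((ρ - s) / κ) • (S.C * (E⁻¹ * F⁻¹) * S.B) := by
    simp only [Matrix.mul_smul, Matrix.smul_mul]
    congr 1
    calc _ = S.C * E⁻¹ * F⁻¹ * (E * E⁻¹) * S.B := by simp only [Matrix.mul_assoc]
      _ = _ := by rw [hEN, Matrix.mul_one, Matrix.mul_assoc S.C]
  rw [h1, smul_add, smul_smul, smul_smul, mul_div_cancel₀ _ hκ, mul_inv_cancel₀ hκ, one_smul,
    ← add_assoc]
  congr 1
  conv_lhs => rw [key]
  simp only [Matrix.mul_add, Matrix.add_mul, Matrix.mul_smul, Matrix.smul_mul]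

lemma lowerMap_A (S : Realization n m p) {ρ w : ℝ} (hw : 0 < w) (hS : IsUnit S.A.det) :
    (S.lowerMap ρ w).A = (gain ρ w : ℂ)⁻¹ •
      (((w : ℂ) ^ 2) • (-S.A)⁻¹ + (ρ : ℂ) • (1 : Matrix (Fin n) (Fin n) ℂ)) := by
  have hw' : (w : ℂ) ≠ 0 := by exact_mod_cast hw.ne'
  have hu : IsUnit (-S.A).det := by
    rw [Matrix.det_neg]; exact (isUnit_one.neg.pow _).mul hS
  change ((gain ρ w : ℂ)⁻¹ * (w : ℂ)) • ((-S.A)⁻¹ * ((w : ℂ) • (1 : Matrix (Fin n) (Fin n) ℂ)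
    + ((ρ : ℂ) / (w : ℂ)) • (-S.A))) = _
  rw [mul_add, mul_smul_comm, mul_smul_comm, mul_one, Matrix.nonsing_inv_mul _ hu, mul_smul,
    smul_add, smul_smul, smul_smul, mul_div_cancel₀ _ hw', sq]

lemma lowerMap_transfer (S : Realization n m p) {ρ w : ℝ} (hw : 0 < w)
    (hS : IsUnit S.A.det) {s : ℂ} (hs : s ≠ 0)
    (hz : IsUnit (((gain ρ w : ℂ)⁻¹ * (ρ - w ^ 2 / s)) • (1 : Matrix (Fin n) (Fin n) ℂ)
      - (S.lowerMap ρ w).A).det) :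
    IsUnit (s • (1 : Matrix (Fin n) (Fin n) ℂ) - S.A).det ∧
      S.transfer s =
        (gain ρ w : ℂ) • (S.lowerMap ρ w).transfer ((gain ρ w : ℂ)⁻¹ * (ρ - w ^ 2 / s)) := by
  have hκ : (gain ρ w : ℂ) ≠ 0 := by exact_mod_cast (gain_pos ρ hw).ne'
  have hw' : (w : ℂ) ≠ 0 := by exact_mod_cast hw.ne'
  have hu : IsUnit (-S.A).det := by
    rw [Matrix.det_neg]; exact (isUnit_one.neg.pow _).mul hS
  have hlA := lowerMap_A S (ρ := ρ) hw hS
  set κ : ℂ := (gain ρ w : ℂ) with hκd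
  set E : Matrix (Fin n) (Fin n) ℂ := -S.A with hE
  set F : Matrix (Fin n) (Fin n) ℂ := s • (1 : Matrix (Fin n) (Fin n) ℂ) - S.A with hF
  have hNE : E⁻¹ * E = 1 := Matrix.nonsing_inv_mul _ hu
  have hEN : E * E⁻¹ = 1 := Matrix.mul_nonsing_inv _ hu
  have hEF : F = s • 1 + E := by rw [hE, hF]; abel
  have hA : (κ⁻¹ * (ρ - w ^ 2 / s)) • (1 : Matrix (Fin n) (Fin n) ℂ) - (S.lowerMap ρ w).A
      = (-(κ⁻¹ * w ^ 2 / s)) • (E⁻¹ * F) := by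
    rw [hlA, hEF, mul_add, hNE, mul_smul_comm, mul_one]
    simp only [smul_add, smul_smul]
    rw [show -(κ⁻¹ * (w : ℂ) ^ 2 / s) * s = -(κ⁻¹ * w ^ 2) by field_simp]
    module
  have hFu : IsUnit F.det := by
    rw [hA, Matrix.det_smul, Matrix.det_mul] at hz
    exact isUnit_of_mul_isUnit_right (isUnit_of_mul_isUnit_right hz)
  refine ⟨hFu, ?_⟩
  have hFF : F * F⁻¹ = 1 := Matrix.mul_nonsing_inv _ hFu
  have hinv : ((-(κ⁻¹ * w ^ 2 / s)) • (E⁻¹ * F))⁻¹ = (-(κ * s / w ^ 2)) • (F⁻¹ * E) := by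
    refine Matrix.inv_eq_right_inv ?_
    rw [smul_mul_smul_comm, show E⁻¹ * F * (F⁻¹ * E) = E⁻¹ * (F * F⁻¹) * E by noncomm_ring, hFF,
      mul_one, hNE, show -(κ⁻¹ * (w : ℂ) ^ 2 / s) * -(κ * s / w ^ 2) = 1 by field_simp, one_smul]
  have key : F⁻¹ = E⁻¹ - s • (E⁻¹ * F⁻¹) := by
    have : E⁻¹ * (F * F⁻¹) = s • (E⁻¹ * F⁻¹) + F⁻¹ := by
      rw [← mul_assoc, hEF, mul_add, hNE, ← hEF]
      simp only [mul_smul_comm, add_mul, smul_mul_assoc, mul_one, one_mul]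
    rw [hFF, mul_one] at this
    rw [eq_sub_iff_add_eq, add_comm, ← this]
  unfold Realization.transfer
  rw [hA, hinv]
  change S.C * F⁻¹ * S.B + S.D = κ • (((κ⁻¹ * w) • (S.C * E⁻¹)) * ((-(κ * s / w ^ 2)) • (F⁻¹ * E))
      * ((κ⁻¹ * w) • (E⁻¹ * S.B)) + (κ⁻¹ • (S.C * E⁻¹ * S.B) + κ⁻¹ • S.D))
  have h1 : ((κ⁻¹ * w) • (S.C * E⁻¹)) * ((-(κ * s / w ^ 2)) • (F⁻¹ * E))
      * ((κ⁻¹ * w) • (E⁻¹ * S.B)) = (-(κ⁻¹ * s)) • (S.C * (E⁻¹ * F⁻¹) * S.B) := by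
    simp only [Matrix.mul_smul, Matrix.smul_mul, smul_smul]
    congr 1
    · field_simp
    · calc _ = S.C * E⁻¹ * F⁻¹ * (E * E⁻¹) * S.B := by simp only [Matrix.mul_assoc]
        _ = _ := by rw [hEN, Matrix.mul_one, Matrix.mul_assoc S.C]
  rw [h1, smul_add, smul_add, smul_smul, smul_smul, smul_smul, mul_inv_cancel₀ hκ, one_smul,
    one_smul, show κ * -(κ⁻¹ * s) = -s by field_simp, ← add_assoc]
  congr 1
  conv_lhs => rw [key]
  simp only [Matrix.mul_sub, Matrix.sub_mul, Matrix.mul_smul, Matrix.smul_mul]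
  module

/-- The value of the transfer function at the point that the mapping of a routing sends to
infinity (`ρ` for the upper type, `0` for the lower type). -/
lemma transfer_eq_of_mapped_infinity (k : Routing) (ρ : ℝ) {w : ℝ} (hw : 0 < w)
    (S : Realization n m p) (hS : k.MapDefined S ρ) {s : ℂ}
    (hs : match k with | .upper => s = ρ | .lower => s = 0) :
    IsUnit (s • (1 : Matrix (Fin n) (Fin n) ℂ) - S.A).det ∧
      S.transfer s = (gain ρ w : ℂ) • (k.mapped S ρ w).D := by
  have hκ : (gain ρ w : ℂ) ≠ 0 := by exact_mod_cast (gain_pos ρ hw).ne'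
  cases k with
  | upper =>
    subst hs
    refine ⟨hS, ?_⟩
    change _ = (gain ρ w : ℂ) • ((gain ρ w : ℂ)⁻¹ • (_ : Matrix (Fin p) (Fin m) ℂ))
    rw [smul_smul, mul_inv_cancel₀ hκ, one_smul]
    rfl
  | lower =>
    subst hs
    have hu : IsUnit (-S.A).det := by
      rw [Matrix.det_neg]; exact (isUnit_one.neg.pow _).mul hS
    rw [zero_smul, zero_sub]
    refine ⟨hu, ?_⟩
    change S.C * ((0 : ℂ) • (1 : Matrix (Fin n) (Fin n) ℂ) - S.A)⁻¹ * S.B + S.D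
      = (gain ρ w : ℂ) • ((gain ρ w : ℂ)⁻¹ • (_ : Matrix (Fin p) (Fin m) ℂ) + _ • S.D)
    rw [zero_smul, zero_sub, ← smul_add, smul_smul, mul_inv_cancel₀ hκ, one_smul]

/-- The mapping of a routing sends the point `jω` of the band either to infinity or to a point `z`
with `1 ≤ ‖z‖`. Both alternatives hold uniformly in the system, so that they apply to a system
and to its reduced model at the same `z`. -/
lemma band_dichotomy (k : Routing) (ρ : ℝ) {w : ℝ} (hw : 0 < w) {ω : ℝ}
    (hω : ω ∈ Set.Icc (-w) w) (m p : ℕ) :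
    (∀ {n : ℕ} (S : Realization n m p), k.MapDefined S ρ →
      IsUnit ((I * (ω : ℂ)) • (1 : Matrix (Fin n) (Fin n) ℂ) - S.A).det ∧
      S.transfer (I * ω) = (gain ρ w : ℂ) • (k.mapped S ρ w).D) ∨
    ∃ z : ℂ, 1 ≤ ‖z‖ ∧ ∀ {n : ℕ} (S : Realization n m p), k.MapDefined S ρ →
      IsUnit (z • (1 : Matrix (Fin n) (Fin n) ℂ) - (k.mapped S ρ w).A).det →
      IsUnit ((I * (ω : ℂ)) • (1 : Matrix (Fin n) (Fin n) ℂ) - S.A).det ∧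
      S.transfer (I * ω) = (gain ρ w : ℂ) • (k.mapped S ρ w).transfer z := by
  have hω2 : ω ^ 2 ≤ w ^ 2 := sq_le_sq' hω.1 hω.2
  have hnorm : ∀ x y : ℝ, ‖(x : ℂ) - I * y‖ = √(x ^ 2 + y ^ 2) := by
    intro x y
    rw [Complex.norm_def, Complex.normSq_apply]
    congr 1
    simp
    ring
  cases k with
  | upper =>
    by_cases h : (ρ : ℂ) - I * ω = 0
    · left
      intro n S hS
      exact transfer_eq_of_mapped_infinity .upper ρ hw S hS (sub_eq_zero.mp h).symm
    · right
      refine ⟨(gain ρ w : ℂ) / (ρ - I * ω), ?_, fun S hS hz => upperMap_transfer S hw hS h hz⟩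
      rw [norm_div, one_le_div (norm_pos_iff.mpr h), hnorm, Complex.norm_real,
        Real.norm_of_nonneg (gain_pos ρ hw).le]
      exact Real.sqrt_le_sqrt (by linarith)
  | lower =>
    by_cases h : I * (ω : ℂ) = 0
    · left
      intro n S hS
      exact transfer_eq_of_mapped_infinity .lower ρ hw S hS h
    · right
      refine ⟨(gain ρ w : ℂ)⁻¹ * (ρ - w ^ 2 / (I * ω)), ?_,
        fun S hS hz => lowerMap_transfer S hw hS h hz⟩
      have hω0 : ω ≠ 0 := fun h0 => h (by simp [h0])
      have hω0' : (ω : ℂ) ≠ 0 := by exact_mod_cast hω0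
      have e : (ρ : ℂ) - w ^ 2 / (I * ω) = (ρ : ℂ) - I * ((-(w ^ 2 / ω) : ℝ) : ℂ) := by
        push_cast
        field_simp
        linear_combination (-(w : ℂ) ^ 2) * Complex.I_sq
      rw [norm_mul, norm_inv, e, hnorm, Complex.norm_real,
        Real.norm_of_nonneg (gain_pos ρ hw).le, ← div_eq_inv_mul, one_le_div (gain_pos ρ hw)]
      refine Real.sqrt_le_sqrt ?_
      have hpos : 0 < ω ^ 2 := by positivity
      have : w ^ 2 ≤ (-(w ^ 2 / ω)) ^ 2 := by
        rw [neg_sq, div_pow, le_div_iff₀ hpos]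
        nlinarith [sq_nonneg w]
      linarith

lemma mapDefined_unmapped (k : Routing) {ρ w : ℝ} (hw : 0 < w) (R : Realization n m p)
    (hR : k.InvDefined R ρ w) : k.MapDefined (k.unmapped R ρ w) ρ := by
  have hκ : (gain ρ w : ℂ) ≠ 0 := by exact_mod_cast (gain_pos ρ hw).ne'
  have hw' : (w : ℂ) ≠ 0 := by exact_mod_cast hw.ne'
  cases k with
  | upper =>
    change IsUnit ((ρ : ℂ) • (1 : Matrix (Fin n) (Fin n) ℂ)
      - ((ρ : ℂ) • (1 : Matrix (Fin n) (Fin n) ℂ) - (gain ρ w : ℂ) • R.A⁻¹)).det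
    rw [sub_sub_cancel, Matrix.det_smul]
    exact (IsUnit.mk0 _ (pow_ne_zero _ hκ)).mul (Matrix.isUnit_nonsing_inv_det _ hR)
  | lower =>
    change IsUnit (((w : ℂ) ^ 2) •
      ((ρ : ℂ) • (1 : Matrix (Fin n) (Fin n) ℂ) - (gain ρ w : ℂ) • R.A)⁻¹).det
    rw [Matrix.det_smul]
    exact (IsUnit.mk0 _ (pow_ne_zero _ (pow_ne_zero _ hw'))).mul
      (Matrix.isUnit_nonsing_inv_det _ hR)

lemma mapped_unmapped (k : Routing) {ρ w : ℝ} (hw : 0 < w) (R : Realization n m p)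
    (hR : k.InvDefined R ρ w) : k.mapped (k.unmapped R ρ w) ρ w = R := by
  have hκ : (gain ρ w : ℂ) ≠ 0 := by exact_mod_cast (gain_pos ρ hw).ne'
  have hw' : (w : ℂ) ≠ 0 := by exact_mod_cast hw.ne'
  have hM := mapDefined_unmapped k hw R hR
  obtain ⟨A, B, C, D⟩ := R
  cases k with
  | upper =>
    set X := Realization.upperInv ⟨A, B, C, D⟩ ρ w with hX
    set E : Matrix (Fin n) (Fin n) ℂ := (ρ : ℂ) • (1 : Matrix (Fin n) (Fin n) ℂ) - X.A with hE
    have hEu : IsUnit E.det := hM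
    have hEA : E = (gain ρ w : ℂ) • A⁻¹ := sub_sub_cancel _ _
    have hNE : E⁻¹ * E = 1 := Matrix.nonsing_inv_mul _ hEu
    have hEN : E * E⁻¹ = 1 := Matrix.mul_nonsing_inv _ hEu
    have hN : E⁻¹ = (gain ρ w : ℂ)⁻¹ • A := by
      refine Matrix.inv_eq_right_inv ?_
      rw [hEA, smul_mul_smul_comm, mul_inv_cancel₀ hκ, one_smul]
      exact Matrix.nonsing_inv_mul _ hR
    have hB : E⁻¹ * X.B = B := by
      change E⁻¹ * (E * B) = B
      rw [← Matrix.mul_assoc, hNE, Matrix.one_mul]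
    have hC : X.C * E⁻¹ = C := by
      change C * E * E⁻¹ = C
      rw [Matrix.mul_assoc, hEN, Matrix.mul_one]
    change Realization.mk ((gain ρ w : ℂ) • E⁻¹) (E⁻¹ * X.B) (X.C * E⁻¹)
      ((gain ρ w : ℂ)⁻¹ • (X.C * E⁻¹ * X.B
        + ((gain ρ w : ℂ) • D - X.C * E⁻¹ * X.B))) = _
    rw [add_sub_cancel, hB, hC, hN, smul_smul, smul_smul, mul_inv_cancel₀ hκ, inv_mul_cancel₀ hκ,
      one_smul, one_smul]
  | lower =>
    set X := Realization.lowerInv ⟨A, B, C, D⟩ ρ w with hX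
    have hEu : IsUnit (-X.A).det := by
      rw [Matrix.det_neg]; exact (isUnit_one.neg.pow _).mul hM
    have hNE : (-X.A)⁻¹ * (-X.A) = 1 := Matrix.nonsing_inv_mul _ hEu
    have hEN : (-X.A) * (-X.A)⁻¹ = 1 := Matrix.mul_nonsing_inv _ hEu
    have hN : (-X.A)⁻¹ = (-((w : ℂ) ^ 2)⁻¹) •
        ((ρ : ℂ) • (1 : Matrix (Fin n) (Fin n) ℂ) - (gain ρ w : ℂ) • A) := by
      refine Matrix.inv_eq_right_inv ?_
      change (-(((w : ℂ) ^ 2) •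
        ((ρ : ℂ) • (1 : Matrix (Fin n) (Fin n) ℂ) - (gain ρ w : ℂ) • A)⁻¹)) * _ = _
      rw [← neg_smul, smul_mul_smul_comm, neg_mul_neg, mul_inv_cancel₀ (pow_ne_zero _ hw'),
        one_smul]
      exact Matrix.nonsing_inv_mul _ hR
    have hA := lowerMap_A X (ρ := ρ) hw hM
    rw [hN, smul_smul, show (w : ℂ) ^ 2 * -((w : ℂ) ^ 2)⁻¹ = -1 by field_simp, neg_one_smul,
      neg_sub, sub_add_cancel, smul_smul, inv_mul_cancel₀ hκ, one_smul] at hA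
    have hc : (gain ρ w : ℂ)⁻¹ * (w : ℂ) * ((gain ρ w : ℂ) / (w : ℂ)) = 1 := by field_simp
    have hB : ((gain ρ w : ℂ)⁻¹ * (w : ℂ)) • ((-X.A)⁻¹ * X.B) = B := by
      change ((gain ρ w : ℂ)⁻¹ * (w : ℂ)) •
        ((-X.A)⁻¹ * (((gain ρ w : ℂ) / (w : ℂ)) • (-X.A * B))) = B
      rw [Matrix.mul_smul, smul_smul, hc, one_smul, ← Matrix.mul_assoc, hNE, Matrix.one_mul]
    have hC : ((gain ρ w : ℂ)⁻¹ * (w : ℂ)) • (X.C * (-X.A)⁻¹) = C := by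
      change ((gain ρ w : ℂ)⁻¹ * (w : ℂ)) •
        ((((gain ρ w : ℂ) / (w : ℂ)) • (C * -X.A)) * (-X.A)⁻¹) = C
      rw [Matrix.smul_mul, smul_smul, hc, one_smul, Matrix.mul_assoc, hEN, Matrix.mul_one]
    change Realization.mk (X.lowerMap ρ w).A (((gain ρ w : ℂ)⁻¹ * (w : ℂ)) • ((-X.A)⁻¹ * X.B))
      (((gain ρ w : ℂ)⁻¹ * (w : ℂ)) • (X.C * (-X.A)⁻¹)) ((gain ρ w : ℂ)⁻¹ • (X.C * (-X.A)⁻¹ * X.B)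
      + (gain ρ w : ℂ)⁻¹ • ((gain ρ w : ℂ) • D - X.C * (-X.A)⁻¹ * X.B)) = _
    rw [hA, hB, hC, ← smul_add, add_sub_cancel, smul_smul, inv_mul_cancel₀ hκ, one_smul]

end Mapping

/-! ### Truncation of dissipative systems -/

section Dissipation

variable {n m p : ℕ}

/-- With respect to the diagonal weights `s`, the state equations are dissipative both for the
storage function `∑ sᵢ ‖xᵢ‖²` (observability side, free response) and for `∑ sᵢ⁻¹ ‖xᵢ‖²`
(controllability side, forced response). For positive weights these are the quadratic-form versions
of the Lyapunov inequalities for the Gramian `diag s`. -/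
structure Realization.IsDissipative (S : Realization n m p) (s : Fin n → ℝ) : Prop where
  obs : ∀ x : Fin n → ℂ, ∑ i, s i * ‖(S.A *ᵥ x) i‖ ^ 2 + ∑ j, ‖(S.C *ᵥ x) j‖ ^ 2 ≤
    ∑ i, s i * ‖x i‖ ^ 2
  ctrl : ∀ (x : Fin n → ℂ) (u : Fin m → ℂ),
    ∑ i, (s i)⁻¹ * ‖(S.A *ᵥ x + S.B *ᵥ u) i‖ ^ 2 ≤ ∑ i, (s i)⁻¹ * ‖x i‖ ^ 2 + ∑ j, ‖u j‖ ^ 2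

/-- Drop the last state. -/
abbrev Realization.dropLast (S : Realization (n + 1) m p) : Realization n m p :=
  S.truncate n n.le_succ

lemma mulVec_snoc_zero {ι : Type*} (M : Matrix ι (Fin (n + 1)) ℂ) (y : Fin n → ℂ) (i : ι) :
    (M *ᵥ (Fin.snoc y 0 : Fin (n + 1) → ℂ)) i = ∑ j : Fin n, M i j.castSucc * y j := by
  simp [Matrix.mulVec, dotProduct, Fin.sum_univ_castSucc]

lemma dropLast_A_mulVec (S : Realization (n + 1) m p) (y : Fin n → ℂ) (i : Fin n) :
    (S.dropLast.A *ᵥ y) i = (S.A *ᵥ (Fin.snoc y 0 : Fin (n + 1) → ℂ)) i.castSucc :=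
  (mulVec_snoc_zero S.A y i.castSucc).symm

lemma dropLast_C_mulVec (S : Realization (n + 1) m p) (y : Fin n → ℂ) :
    S.dropLast.C *ᵥ y = S.C *ᵥ (Fin.snoc y 0 : Fin (n + 1) → ℂ) :=
  funext fun i => (mulVec_snoc_zero S.C y i).symm

lemma dropLast_B_mulVec (S : Realization (n + 1) m p) (u : Fin m → ℂ) (i : Fin n) :
    (S.dropLast.B *ᵥ u) i = (S.B *ᵥ u) i.castSucc := rfl

lemma Realization.IsDissipative.dropLast {S : Realization (n + 1) m p} {s : Fin (n + 1) → ℝ}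
    (hS : S.IsDissipative s) (hs : ∀ i, 0 < s i) :
    S.dropLast.IsDissipative (fun i => s i.castSucc) where
  obs y := by
    have h := hS.obs (Fin.snoc y 0)
    simp only [Fin.sum_univ_castSucc, Fin.snoc_castSucc, Fin.snoc_last, norm_zero] at h
    rw [dropLast_C_mulVec]
    simp only [dropLast_A_mulVec]
    have := mul_nonneg (hs (Fin.last n)).le
      (sq_nonneg ‖(S.A *ᵥ (Fin.snoc y 0 : Fin (n + 1) → ℂ)) (Fin.last n)‖)
    linarith
  ctrl y u := by
    have h := hS.ctrl (Fin.snoc y 0) u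
    simp only [Fin.sum_univ_castSucc, Fin.snoc_castSucc, Fin.snoc_last, norm_zero] at h
    simp only [Pi.add_apply, dropLast_A_mulVec, dropLast_B_mulVec] at h ⊢
    have := mul_nonneg (inv_pos.mpr (hs (Fin.last n))).le
      (sq_nonneg ‖(S.A *ᵥ (Fin.snoc y 0 : Fin (n + 1) → ℂ)) (Fin.last n)
        + (S.B *ᵥ u) (Fin.last n)‖)
    linarith

lemma resolvent_mulVec (A : Matrix (Fin n) (Fin n) ℂ) (z : ℂ) (x : Fin n → ℂ) :
    (z • (1 : Matrix (Fin n) (Fin n) ℂ) - A) *ᵥ x = z • x - A *ᵥ x := by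
  rw [Matrix.sub_mulVec, Matrix.smul_mulVec, Matrix.one_mulVec]

/-- Dropping a state of a dissipative system creates no eigenvalue outside the open unit disc: by
the observability inequality, an eigenvector of the compressed state matrix for an eigenvalue `z`
with `1 ≤ ‖z‖`, extended by zero, is an eigenvector of the full state matrix. -/
lemma isUnit_resolvent_dropLast {S : Realization (n + 1) m p} {s : Fin (n + 1) → ℝ}
    (hS : S.IsDissipative s) (hs : ∀ i, 0 < s i) {z : ℂ} (hz : 1 ≤ ‖z‖)
    (hA : IsUnit (z • (1 : Matrix (Fin (n + 1)) (Fin (n + 1)) ℂ) - S.A).det) :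
    IsUnit (z • (1 : Matrix (Fin n) (Fin n) ℂ) - S.dropLast.A).det := by
  rw [isUnit_iff_ne_zero] at hA ⊢
  intro h0
  obtain ⟨y, hy0, hy⟩ := Matrix.exists_mulVec_eq_zero_iff.mpr h0
  refine hA (Matrix.exists_mulVec_eq_zero_iff.mp ⟨Fin.snoc y 0, ?_, ?_⟩)
  · intro h
    refine hy0 (funext fun i => ?_)
    simpa using congrFun h i.castSucc
  rw [resolvent_mulVec, sub_eq_zero] at hy
  have hAy : ∀ i : Fin n, (S.A *ᵥ (Fin.snoc y 0 : Fin (n + 1) → ℂ)) i.castSucc = z * y i := by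
    intro i
    rw [← dropLast_A_mulVec, ← hy]
    rfl
  have h := hS.obs (Fin.snoc y 0)
  simp only [Fin.sum_univ_castSucc, Fin.snoc_castSucc, Fin.snoc_last, norm_zero, hAy] at h
  have h1 : ∑ i : Fin n, s i.castSucc * ‖y i‖ ^ 2 ≤ ∑ i : Fin n, s i.castSucc * ‖z * y i‖ ^ 2 := by
    refine Finset.sum_le_sum fun i _ => mul_le_mul_of_nonneg_left ?_ (hs _).le
    rw [norm_mul, mul_pow]
    exact le_mul_of_one_le_left (sq_nonneg _) (one_le_pow₀ hz)
  have h2 : 0 ≤ ∑ j, ‖(S.C *ᵥ (Fin.snoc y 0 : Fin (n + 1) → ℂ)) j‖ ^ 2 :=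
    Finset.sum_nonneg fun _ _ => sq_nonneg _
  have h3 : s (Fin.last n) *
      ‖(S.A *ᵥ (Fin.snoc y 0 : Fin (n + 1) → ℂ)) (Fin.last n)‖ ^ 2 ≤ 0 := by linarith
  have h4 : (S.A *ᵥ (Fin.snoc y 0 : Fin (n + 1) → ℂ)) (Fin.last n) = 0 := by
    by_contra hne
    have := mul_pos (hs (Fin.last n)) (pow_pos (norm_pos_iff.mpr hne) 2)
    linarith
  rw [resolvent_mulVec]
  funext i
  refine Fin.lastCases ?_ (fun i => ?_) i
  · simp [h4]
  · simp [hAy]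

/-- The error system of a one-state truncation has gain at most `2σ`, where `σ` is the weight of the
dropped state. With `x`, `y` the two states and `x̂ = (y, 0)`, the storage function is
`∑ sᵢ ‖(x - x̂)ᵢ‖² + σ² ∑ sᵢ⁻¹ ‖(x + x̂)ᵢ‖²`. -/
lemma output_error_dropLast {S : Realization (n + 1) m p} {s : Fin (n + 1) → ℝ}
    (hS : S.IsDissipative s) (hs : ∀ i, 0 < s i) {z : ℂ} (hz : 1 ≤ ‖z‖)
    {x : Fin (n + 1) → ℂ} {y : Fin n → ℂ} {u : Fin m → ℂ}
    (hx : z • x = S.A *ᵥ x + S.B *ᵥ u)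
    (hy : z • y = S.dropLast.A *ᵥ y + S.dropLast.B *ᵥ u) :
    ∑ j, ‖(S.C *ᵥ x - S.dropLast.C *ᵥ y) j‖ ^ 2 ≤
      (2 * s (Fin.last n)) ^ 2 * ∑ j, ‖u j‖ ^ 2 := by
  set e : Fin (n + 1) → ℂ := Fin.snoc y 0 with he
  set σ := s (Fin.last n) with hσ
  set h : ℂ := (S.A *ᵥ e + S.B *ᵥ u) (Fin.last n) with hh
  have hσ0 : 0 < σ := hs _
  have hx' : ∀ i, (S.A *ᵥ x) i = z * x i - (S.B *ᵥ u) i := fun i => by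
    rw [eq_sub_iff_add_eq]; exact (congrFun hx i).symm
  have hy' : ∀ i : Fin n, (S.A *ᵥ e) i.castSucc = z * y i - (S.B *ᵥ u) i.castSucc := fun i => by
    rw [eq_sub_iff_add_eq, he, ← dropLast_A_mulVec]; exact (congrFun hy i).symm
  have hl : (S.A *ᵥ e) (Fin.last n) = h - (S.B *ᵥ u) (Fin.last n) := by
    rw [hh, Pi.add_apply]; ring
  have hec : ∀ i : Fin n, e i.castSucc = y i := fun i => by rw [he, Fin.snoc_castSucc]
  have hel : e (Fin.last n) = 0 := by rw [he, Fin.snoc_last]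
  have ho := hS.obs (x - e)
  have hc := hS.ctrl (x + e) ((2 : ℂ) • u)
  rw [Matrix.mulVec_sub, Matrix.mulVec_sub] at ho
  rw [Matrix.mulVec_add, Matrix.mulVec_smul] at hc
  simp only [Fin.sum_univ_castSucc, Pi.sub_apply, Pi.add_apply, Pi.smul_apply, smul_eq_mul, hx',
    hy', hl, hec, hel, sub_zero, add_zero] at ho hc
  simp only [norm_mul, mul_pow, Complex.norm_ofNat] at hc
  rw [← Finset.mul_sum, show z * x (Fin.last n) - (S.B *ᵥ u) (Fin.last n)
    + (h - (S.B *ᵥ u) (Fin.last n)) + 2 * (S.B *ᵥ u) (Fin.last n) = z * x (Fin.last n) + h by ring]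
    at hc
  have ho1 : ∑ i : Fin n, s i.castSucc * ‖x i.castSucc - y i‖ ^ 2 ≤
      ∑ i : Fin n, s i.castSucc * ‖z * x i.castSucc - (S.B *ᵥ u) i.castSucc
        - (z * y i - (S.B *ᵥ u) i.castSucc)‖ ^ 2 := by
    refine Finset.sum_le_sum fun i _ => mul_le_mul_of_nonneg_left ?_ (hs _).le
    rw [sub_sub_sub_cancel_right, ← mul_sub, norm_mul, mul_pow]
    exact le_mul_of_one_le_left (sq_nonneg _) (one_le_pow₀ hz)
  have hc1 : ∑ i : Fin n, (s i.castSucc)⁻¹ * ‖x i.castSucc + y i‖ ^ 2 ≤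
      ∑ i : Fin n, (s i.castSucc)⁻¹ * ‖z * x i.castSucc - (S.B *ᵥ u) i.castSucc
        + (z * y i - (S.B *ᵥ u) i.castSucc) + 2 * (S.B *ᵥ u) i.castSucc‖ ^ 2 := by
    refine Finset.sum_le_sum fun i _ =>
      mul_le_mul_of_nonneg_left ?_ (inv_pos.mpr (hs _)).le
    rw [show z * x i.castSucc - (S.B *ᵥ u) i.castSucc + (z * y i - (S.B *ᵥ u) i.castSucc)
      + 2 * (S.B *ᵥ u) i.castSucc = z * (x i.castSucc + y i) by ring, norm_mul, mul_pow]
    exact le_mul_of_one_le_left (sq_nonneg _) (one_le_pow₀ hz)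
  rw [show z * x (Fin.last n) - (S.B *ᵥ u) (Fin.last n) - (h - (S.B *ᵥ u) (Fin.last n))
    = z * x (Fin.last n) - h by ring] at ho
  rw [← hσ] at ho hc
  have hc2 : σ⁻¹ * ‖z * x (Fin.last n) + h‖ ^ 2 ≤
      σ⁻¹ * ‖x (Fin.last n)‖ ^ 2 + 2 ^ 2 * ∑ j, ‖u j‖ ^ 2 := by linarith
  have hc3 : σ * ‖z * x (Fin.last n) + h‖ ^ 2 ≤
      σ * ‖x (Fin.last n)‖ ^ 2 + (2 * σ) ^ 2 * ∑ j, ‖u j‖ ^ 2 := by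
    have := mul_le_mul_of_nonneg_left hc2 (sq_nonneg σ)
    rw [mul_add, ← mul_assoc, ← mul_assoc, ← mul_assoc, sq σ, mul_assoc σ σ σ⁻¹,
      mul_inv_cancel₀ hσ0.ne', mul_one] at this
    linarith
  -- In the last coordinate the terms linear in `h` cancel between the two storage functions.
  have hpar : 2 * ‖x (Fin.last n)‖ ^ 2 ≤
      ‖z * x (Fin.last n) - h‖ ^ 2 + ‖z * x (Fin.last n) + h‖ ^ 2 := by
    have h1 := parallelogram_law_with_norm ℝ (z * x (Fin.last n)) h
    have h2 : ‖x (Fin.last n)‖ ^ 2 ≤ ‖z * x (Fin.last n)‖ ^ 2 := by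
      rw [norm_mul, mul_pow]
      exact le_mul_of_one_le_left (sq_nonneg _) (one_le_pow₀ hz)
    nlinarith [sq_nonneg ‖h‖]
  have hpar' := mul_le_mul_of_nonneg_left hpar hσ0.le
  rw [dropLast_C_mulVec, ← he]
  simp only [Pi.sub_apply]
  linarith

lemma sigmaMax_le {M : Matrix (Fin p) (Fin m) ℂ} {c : ℝ} (hc : 0 ≤ c)
    (h : ∀ u : Fin m → ℂ, ∑ j, ‖(M *ᵥ u) j‖ ^ 2 ≤ c ^ 2 * ∑ j, ‖u j‖ ^ 2) : sigmaMax M ≤ c := by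
  unfold sigmaMax
  rw [Matrix.l2_opNorm_def]
  refine ContinuousLinearMap.opNorm_le_bound _ hc fun u => ?_
  refine le_of_sq_le_sq ?_ (by positivity)
  rw [mul_pow, EuclideanSpace.norm_sq_eq, EuclideanSpace.norm_sq_eq]
  exact h u.ofLp

lemma sigmaMax_add_le (M N : Matrix (Fin p) (Fin m) ℂ) :
    sigmaMax (M + N) ≤ sigmaMax M + sigmaMax N := by
  open scoped Matrix.Norms.L2Operator in exact norm_add_le M N

lemma sigmaMax_smul (c : ℂ) (M : Matrix (Fin p) (Fin m) ℂ) :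
    sigmaMax (c • M) = ‖c‖ * sigmaMax M := by
  open scoped Matrix.Norms.L2Operator in exact norm_smul c M

lemma sigmaMax_zero : sigmaMax (0 : Matrix (Fin p) (Fin m) ℂ) = 0 := by
  open scoped Matrix.Norms.L2Operator in exact norm_zero

lemma smul_resolvent_inv_mulVec {A : Matrix (Fin n) (Fin n) ℂ} {z : ℂ}
    (hA : IsUnit (z • (1 : Matrix (Fin n) (Fin n) ℂ) - A).det) (v : Fin n → ℂ) :
    z • ((z • (1 : Matrix (Fin n) (Fin n) ℂ) - A)⁻¹ *ᵥ v) =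
      A *ᵥ ((z • (1 : Matrix (Fin n) (Fin n) ℂ) - A)⁻¹ *ᵥ v) + v := by
  have h : (z • (1 : Matrix (Fin n) (Fin n) ℂ) - A) *ᵥ
      ((z • (1 : Matrix (Fin n) (Fin n) ℂ) - A)⁻¹ *ᵥ v) = v := by
    rw [Matrix.mulVec_mulVec, Matrix.mul_nonsing_inv _ hA, Matrix.one_mulVec]
  rw [resolvent_mulVec] at h
  rw [← sub_eq_iff_eq_add', h]

lemma sigmaMax_transfer_sub_dropLast_le {S : Realization (n + 1) m p} {s : Fin (n + 1) → ℝ}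
    (hS : S.IsDissipative s) (hs : ∀ i, 0 < s i) {z : ℂ} (hz : 1 ≤ ‖z‖)
    (hA : IsUnit (z • (1 : Matrix (Fin (n + 1)) (Fin (n + 1)) ℂ) - S.A).det) :
    sigmaMax (S.transfer z - S.dropLast.transfer z) ≤ 2 * s (Fin.last n) := by
  have hA' := isUnit_resolvent_dropLast hS hs hz hA
  refine sigmaMax_le (by linarith [hs (Fin.last n)]) fun u => ?_
  refine le_of_eq_of_le ?_ (output_error_dropLast hS hs hz
    (smul_resolvent_inv_mulVec hA (S.B *ᵥ u)) (smul_resolvent_inv_mulVec hA' (S.dropLast.B *ᵥ u)))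
  simp only [Matrix.mulVec_mulVec, ← Matrix.mul_assoc]
  rw [← Matrix.sub_mulVec]
  unfold Realization.transfer
  rw [show S.dropLast.D = S.D from rfl, add_sub_add_right_eq_sub]

/-- The twice-the-tail bound for the truncation of a dissipative system, at every point outside
the open unit disc. The states are dropped one at a time, so that no weight needs to be simple. -/
theorem sigmaMax_transfer_sub_truncate_le {S : Realization n m p} {s : Fin n → ℝ}
    (hS : S.IsDissipative s) (hs : ∀ i, 0 < s i) {z : ℂ} (hz : 1 ≤ ‖z‖)
    (hA : IsUnit (z • (1 : Matrix (Fin n) (Fin n) ℂ) - S.A).det) (r : ℕ) (hr : r ≤ n) :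
    IsUnit (z • (1 : Matrix (Fin r) (Fin r) ℂ) - (S.truncate r hr).A).det ∧
      sigmaMax (S.transfer z - (S.truncate r hr).transfer z) ≤
        2 * ∑ i ∈ Finset.univ.filter (fun i : Fin n => r ≤ (i : ℕ)), s i := by
  have hself : ∀ {k : ℕ} (R : Realization k m p), R.truncate k le_rfl = R := fun _ => rfl
  induction n with
  | zero =>
    obtain rfl : r = 0 := by omega
    rw [hself, sub_self, sigmaMax_zero]
    exact ⟨hA, by simp⟩
  | succ n ih =>
    rcases hr.eq_or_lt with rfl | hlt
    · rw [hself, sub_self, sigmaMax_zero]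
      exact ⟨hA, mul_nonneg zero_le_two (Finset.sum_nonneg fun i _ => (hs i).le)⟩
    · have hr' : r ≤ n := Nat.lt_succ_iff.mp hlt
      obtain ⟨h1, h2⟩ := ih (hS.dropLast hs) (fun i => hs _)
        (isUnit_resolvent_dropLast hS hs hz hA) hr'
      have htr : S.dropLast.truncate r hr' = S.truncate r hr := rfl
      rw [htr] at h1 h2
      refine ⟨h1, ?_⟩
      have h3 := sigmaMax_transfer_sub_dropLast_le hS hs hz hA
      have h4 := sigmaMax_add_le (S.transfer z - S.dropLast.transfer z)
        (S.dropLast.transfer z - (S.truncate r hr).transfer z)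
      rw [sub_add_sub_cancel] at h4
      rw [Finset.sum_filter, Fin.sum_univ_castSucc, Fin.val_last, if_pos hr']
      rw [Finset.sum_filter] at h2
      simp only [Fin.val_castSucc]
      linarith

end Dissipation

/-! ### Gramians and balanced coordinates -/

section Balancing

variable {n m p : ℕ}

lemma IsSchurStable.isUnit_resolvent {A : Matrix (Fin n) (Fin n) ℂ} (hA : IsSchurStable A) {z : ℂ}
    (hz : 1 ≤ ‖z‖) : IsUnit (z • (1 : Matrix (Fin n) (Fin n) ℂ) - A).det := by
  by_contra h
  rw [← Matrix.isUnit_iff_isUnit_det, ← Algebra.algebraMap_eq_smul_one] at h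
  exact absurd (hA z (spectrum.mem_iff.mpr h)) hz.not_gt

open scoped Matrix.Norms.L2Operator in
open Filter Topology in
lemma IsSchurStable.tendsto_pow {A : Matrix (Fin n) (Fin n) ℂ} (hA : IsSchurStable A) :
    Tendsto (fun k : ℕ => A ^ k) atTop (𝓝 0) := by
  rcases isEmpty_or_nonempty (Fin n) with hn | hn
  · exact tendsto_const_nhds.congr fun k => Subsingleton.elim _ _
  have hρ : spectralRadius ℂ A < 1 :=
    spectrum.spectralRadius_lt_of_forall_lt A (r := 1) fun μ hμ => by
      simpa [← NNReal.coe_lt_coe] using hA μ hμ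
  obtain ⟨c, hc1, hc2⟩ := exists_between hρ
  have hev := (spectrum.pow_nnnorm_pow_one_div_tendsto_nhds_spectralRadius A).eventually_lt_const
    hc1
  lift c to NNReal using (hc2.trans ENNReal.one_lt_top).ne
  have hc : c < 1 := by exact_mod_cast hc2
  refine squeeze_zero_norm' ?_ (tendsto_pow_atTop_nhds_zero_of_lt_one c.coe_nonneg
    (show (c : ℝ) < 1 by exact_mod_cast hc))
  filter_upwards [hev, eventually_gt_atTop 0] with k hk hk0
  have hk' : (0 : ℝ) < k := by exact_mod_cast hk0
  rw [one_div, ENNReal.rpow_inv_lt_iff hk', ENNReal.rpow_natCast] at hk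
  exact_mod_cast hk.le

open scoped Matrix.Norms.L2Operator in
/-- The homogeneous Stein equation has only the trivial solution, as `X = A ^ k * X * (A ^ k)ᴴ` tends
to zero. -/
lemma eq_zero_of_stein {A X : Matrix (Fin n) (Fin n) ℂ} (hA : IsSchurStable A)
    (h : A * X * Aᴴ = X) : X = 0 := by
  have hk : ∀ k : ℕ, A ^ k * X * (A ^ k)ᴴ = X := by
    intro k
    induction k with
    | zero => simp
    | succ k ih =>
      calc _ = A ^ k * (A * X * Aᴴ) * (A ^ k)ᴴ := by
            rw [pow_succ, Matrix.conjTranspose_mul]; simp only [mul_assoc]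
        _ = X := by rw [h, ih]
  have h1 : Filter.Tendsto (fun k : ℕ => A ^ k * X * (A ^ k)ᴴ) Filter.atTop
      (nhds (0 * X * star 0)) := (hA.tendsto_pow.mul_const X).mul hA.tendsto_pow.star
  simp only [hk, zero_mul] at h1
  exact tendsto_nhds_unique tendsto_const_nhds h1

/-- The dual system, which exchanges the two Gramians. -/
def Realization.dual (S : Realization n m p) : Realization n p m :=
  ⟨S.Aᴴ, S.Cᴴ, S.Bᴴ, S.Dᴴ⟩

lemma IsSchurStable.conjTranspose {A : Matrix (Fin n) (Fin n) ℂ} (hA : IsSchurStable A) :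
    IsSchurStable Aᴴ := by
  intro μ hμ
  rw [← Matrix.star_eq_conjTranspose, spectrum.map_star] at hμ
  simpa using hA _ hμ

lemma Realization.IsControllabilityGramian.dual {S : Realization n m p}
    {P : Matrix (Fin n) (Fin n) ℂ} (h : S.IsControllabilityGramian P) :
    S.dual.IsObservabilityGramian P := by
  simpa [IsControllabilityGramian, IsObservabilityGramian, Realization.dual] using h

lemma Realization.IsObservabilityGramian.dual {S : Realization n m p}
    {Q : Matrix (Fin n) (Fin n) ℂ} (h : S.IsObservabilityGramian Q) :
    S.dual.IsControllabilityGramian Q := by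
  simpa [IsControllabilityGramian, IsObservabilityGramian, Realization.dual] using h

lemma Realization.IsControllabilityGramian.unique {S : Realization n m p} (hS : IsSchurStable S.A)
    {P P' : Matrix (Fin n) (Fin n) ℂ} (h : S.IsControllabilityGramian P)
    (h' : S.IsControllabilityGramian P') : P = P' := by
  refine sub_eq_zero.mp (eq_zero_of_stein hS ?_)
  have e := sub_eq_zero.mpr (Eq.trans h h'.symm)
  rw [← sub_eq_zero, ← e]
  noncomm_ring

lemma Realization.IsObservabilityGramian.unique {S : Realization n m p} (hS : IsSchurStable S.A)
    {Q Q' : Matrix (Fin n) (Fin n) ℂ} (h : S.IsObservabilityGramian Q)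
    (h' : S.IsObservabilityGramian Q') : Q = Q' :=
  h.dual.unique hS.conjTranspose h'.dual

lemma Realization.IsControllabilityGramian.changeCoords {S : Realization n m p}
    {P T : Matrix (Fin n) (Fin n) ℂ} (h : S.IsControllabilityGramian P) (hT : IsUnit T.det) :
    (S.changeCoords T).IsControllabilityGramian (T * P * Tᴴ) := by
  have e : Tᴴ * (T⁻¹)ᴴ = 1 := by
    rw [← Matrix.conjTranspose_mul, Matrix.nonsing_inv_mul _ hT, Matrix.conjTranspose_one]
  change T * S.A * T⁻¹ * (T * P * Tᴴ) * (T * S.A * T⁻¹)ᴴ - T * P * Tᴴ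
    + T * S.B * (T * S.B)ᴴ = 0
  have h1 : T * S.A * T⁻¹ * (T * P * Tᴴ) * (T * S.A * T⁻¹)ᴴ = T * (S.A * P * S.Aᴴ) * Tᴴ := by
    simp only [Matrix.conjTranspose_mul]
    calc _ = T * S.A * (T⁻¹ * T) * P * (Tᴴ * (T⁻¹)ᴴ) * S.Aᴴ * Tᴴ := by
          simp only [Matrix.mul_assoc]
      _ = _ := by rw [e, Matrix.nonsing_inv_mul _ hT, mul_one, mul_one]; simp only [mul_assoc]
  have h2 : T * S.B * (T * S.B)ᴴ = T * (S.B * S.Bᴴ) * Tᴴ := by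
    simp only [Matrix.conjTranspose_mul, Matrix.mul_assoc]
  rw [h1, h2, ← sub_mul, ← mul_sub, ← add_mul, ← mul_add, h, mul_zero, zero_mul]

lemma Realization.IsObservabilityGramian.changeCoords {S : Realization n m p}
    {Q T : Matrix (Fin n) (Fin n) ℂ} (h : S.IsObservabilityGramian Q) (hT : IsUnit T.det) :
    (S.changeCoords T).IsObservabilityGramian ((T⁻¹)ᴴ * Q * T⁻¹) := by
  have e : Tᴴ * (T⁻¹)ᴴ = 1 := by
    rw [← Matrix.conjTranspose_mul, Matrix.nonsing_inv_mul _ hT, Matrix.conjTranspose_one]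
  change (T * S.A * T⁻¹)ᴴ * ((T⁻¹)ᴴ * Q * T⁻¹) * (T * S.A * T⁻¹) - (T⁻¹)ᴴ * Q * T⁻¹
    + (S.C * T⁻¹)ᴴ * (S.C * T⁻¹) = 0
  have h1 : (T * S.A * T⁻¹)ᴴ * ((T⁻¹)ᴴ * Q * T⁻¹) * (T * S.A * T⁻¹)
      = (T⁻¹)ᴴ * (S.Aᴴ * Q * S.A) * T⁻¹ := by
    simp only [Matrix.conjTranspose_mul]
    calc _ = (T⁻¹)ᴴ * S.Aᴴ * (Tᴴ * (T⁻¹)ᴴ) * Q * (T⁻¹ * T) * S.A * T⁻¹ := by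
          simp only [Matrix.mul_assoc]
      _ = _ := by rw [e, Matrix.nonsing_inv_mul _ hT, mul_one, mul_one]; simp only [mul_assoc]
  have h2 : (S.C * T⁻¹)ᴴ * (S.C * T⁻¹) = (T⁻¹)ᴴ * (S.Cᴴ * S.C) * T⁻¹ := by
    simp only [Matrix.conjTranspose_mul, Matrix.mul_assoc]
  rw [h1, h2, ← sub_mul, ← mul_sub, ← add_mul, ← mul_add, h, mul_zero, zero_mul]

lemma changeCoords_resolvent (S : Realization n m p) {T : Matrix (Fin n) (Fin n) ℂ}
    (hT : IsUnit T.det) (z : ℂ) :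
    z • (1 : Matrix (Fin n) (Fin n) ℂ) - (S.changeCoords T).A
      = T * (z • (1 : Matrix (Fin n) (Fin n) ℂ) - S.A) * T⁻¹ := by
  rw [mul_sub, sub_mul, mul_smul_comm, mul_one, smul_mul_assoc, Matrix.mul_nonsing_inv _ hT]
  rfl

lemma isUnit_resolvent_changeCoords {S : Realization n m p} {T : Matrix (Fin n) (Fin n) ℂ}
    (hT : IsUnit T.det) {z : ℂ} (hA : IsUnit (z • (1 : Matrix (Fin n) (Fin n) ℂ) - S.A).det) :
    IsUnit (z • (1 : Matrix (Fin n) (Fin n) ℂ) - (S.changeCoords T).A).det := by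
  rw [changeCoords_resolvent S hT, Matrix.det_mul, Matrix.det_mul]
  exact (hT.mul hA).mul (Matrix.isUnit_nonsing_inv_det _ hT)

lemma transfer_changeCoords (S : Realization n m p) {T : Matrix (Fin n) (Fin n) ℂ}
    (hT : IsUnit T.det) (z : ℂ) : (S.changeCoords T).transfer z = S.transfer z := by
  unfold Realization.transfer
  rw [changeCoords_resolvent S hT, Matrix.mul_inv_rev, Matrix.mul_inv_rev,
    Matrix.nonsing_inv_nonsing_inv _ hT]
  change S.C * T⁻¹ * (T * ((z • (1 : Matrix (Fin n) (Fin n) ℂ) - S.A)⁻¹ * T⁻¹)) * (T * S.B) + S.D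
    = _
  congr 1
  calc _ = S.C * (T⁻¹ * T) * (z • (1 : Matrix (Fin n) (Fin n) ℂ) - S.A)⁻¹ * (T⁻¹ * T) * S.B := by
        simp only [Matrix.mul_assoc]
    _ = _ := by rw [Matrix.nonsing_inv_mul _ hT, Matrix.mul_one, Matrix.mul_one]

lemma star_dotProduct_self {ι : Type*} [Fintype ι] (a : ι → ℂ) :
    star a ⬝ᵥ a = ((∑ i, ‖a i‖ ^ 2 : ℝ) : ℂ) := by
  push_cast
  exact Finset.sum_congr rfl fun i _ => Complex.conj_mul' (a i)

lemma star_dotProduct_diagonal_mulVec (s : Fin n → ℝ) (a : Fin n → ℂ) :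
    star a ⬝ᵥ (Matrix.diagonal (fun i => ((s i : ℝ) : ℂ)) *ᵥ a)
      = ((∑ i, s i * ‖a i‖ ^ 2 : ℝ) : ℂ) := by
  push_cast
  refine Finset.sum_congr rfl fun i _ => ?_
  rw [Matrix.mulVec_diagonal, ← Complex.conj_mul' (a i), mul_left_comm]
  rfl

lemma star_dotProduct_conjTranspose_mulVec {k l : ℕ} (M : Matrix (Fin k) (Fin l) ℂ)
    (x : Fin l → ℂ) (y : Fin k → ℂ) : star x ⬝ᵥ (Mᴴ *ᵥ y) = star (M *ᵥ x) ⬝ᵥ y := by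
  rw [Matrix.star_mulVec, Matrix.dotProduct_mulVec]

lemma Realization.IsObservabilityGramian.sum_eq {S : Realization n m p} {s : Fin n → ℝ}
    (h : S.IsObservabilityGramian (Matrix.diagonal fun i => ((s i : ℝ) : ℂ))) (x : Fin n → ℂ) :
    ∑ i, s i * ‖(S.A *ᵥ x) i‖ ^ 2 + ∑ j, ‖(S.C *ᵥ x) j‖ ^ 2 = ∑ i, s i * ‖x i‖ ^ 2 := by
  have e := congrArg (fun M => star x ⬝ᵥ (M *ᵥ x)) h
  simp only [Matrix.add_mulVec, Matrix.sub_mulVec, dotProduct_add, dotProduct_sub,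
    Matrix.zero_mulVec, dotProduct_zero] at e
  rw [Matrix.mul_assoc, ← Matrix.mulVec_mulVec, ← Matrix.mulVec_mulVec, ← Matrix.mulVec_mulVec,
    star_dotProduct_conjTranspose_mulVec, star_dotProduct_conjTranspose_mulVec,
    star_dotProduct_diagonal_mulVec, star_dotProduct_diagonal_mulVec, star_dotProduct_self] at e
  norm_cast at e
  linarith

lemma two_mul_re_star_mul_le (a b : ℂ) {t : ℝ} (ht : 0 < t) :
    2 * (star a * b).re ≤ t * ‖a‖ ^ 2 + t⁻¹ * ‖b‖ ^ 2 := by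
  have h1 : (star a * b).re ≤ ‖a‖ * ‖b‖ := by
    refine (Complex.re_le_norm _).trans_eq ?_
    rw [norm_mul, norm_star]
  have h2 : t * ‖a‖ ^ 2 + t⁻¹ * ‖b‖ ^ 2 - 2 * (‖a‖ * ‖b‖) = t⁻¹ * (t * ‖a‖ - ‖b‖) ^ 2 := by
    field_simp
    ring
  have h3 : 0 ≤ t⁻¹ * (t * ‖a‖ - ‖b‖) ^ 2 := by positivity
  linarith

/-- A balanced system is dissipative. The controllability half follows from the Gramian equation
of the dual system at `g = (diag s)⁻¹ (A x + B u)`, by pairing `g` with `A x + B u`. -/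
lemma isDissipative_of_balanced {S : Realization n m p} {s : Fin n → ℝ} (hs : ∀ i, 0 < s i)
    (hP : S.IsControllabilityGramian (Matrix.diagonal fun i => ((s i : ℝ) : ℂ)))
    (hQ : S.IsObservabilityGramian (Matrix.diagonal fun i => ((s i : ℝ) : ℂ))) :
    S.IsDissipative s where
  obs x := (hQ.sum_eq x).le
  ctrl x u := by
    set y := S.A *ᵥ x + S.B *ᵥ u with hy
    set g : Fin n → ℂ := fun i => ((s i)⁻¹ : ℝ) * y i with hg
    have h1 := hP.dual.sum_eq g
    change ∑ i, s i * ‖(S.Aᴴ *ᵥ g) i‖ ^ 2 + ∑ j, ‖(S.Bᴴ *ᵥ g) j‖ ^ 2 = _ at h1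
    have h2 : ∑ i, s i * ‖g i‖ ^ 2 = ∑ i, (s i)⁻¹ * ‖y i‖ ^ 2 := by
      refine Finset.sum_congr rfl fun i _ => ?_
      have := (hs i).ne'
      rw [hg, norm_mul, Complex.norm_real, Real.norm_of_nonneg (inv_pos.mpr (hs i)).le]
      field_simp
    have h3 : star g ⬝ᵥ y = ((∑ i, (s i)⁻¹ * ‖y i‖ ^ 2 : ℝ) : ℂ) := by
      push_cast
      refine Finset.sum_congr rfl fun i _ => ?_
      rw [← Complex.conj_mul' (y i), ← mul_assoc]
      congr 1
      simp [hg]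
    have h4 : star g ⬝ᵥ y = star (S.Aᴴ *ᵥ g) ⬝ᵥ x + star (S.Bᴴ *ᵥ g) ⬝ᵥ u := by
      rw [← star_dotProduct_conjTranspose_mulVec, ← star_dotProduct_conjTranspose_mulVec,
        Matrix.conjTranspose_conjTranspose, Matrix.conjTranspose_conjTranspose, hy, dotProduct_add]
    have h5 : 2 * ∑ i, (s i)⁻¹ * ‖y i‖ ^ 2 =
        ∑ i, 2 * (star ((S.Aᴴ *ᵥ g) i) * x i).re + ∑ j, 2 * (star ((S.Bᴴ *ᵥ g) j) * u j).re := by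
      have := congrArg Complex.re (h3.symm.trans h4)
      rw [Complex.ofReal_re, Complex.add_re] at this
      rw [this, ← Finset.mul_sum, ← Finset.mul_sum, ← mul_add, ← Complex.re_sum,
        ← Complex.re_sum]
      rfl
    have h6 := Finset.sum_le_sum fun i (_ : i ∈ Finset.univ) =>
      two_mul_re_star_mul_le ((S.Aᴴ *ᵥ g) i) (x i) (hs i)
    have h7 := Finset.sum_le_sum fun j (_ : j ∈ Finset.univ) =>
      two_mul_re_star_mul_le ((S.Bᴴ *ᵥ g) j) (u j) one_pos
    simp only [Finset.sum_add_distrib, one_mul, inv_one] at h6 h7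
    linarith

/-- Decreasing listings of nonnegative numbers whose squares are the roots, with multiplicity, of
the same polynomial agree. -/
lemma eq_of_prod_X_sub_C_sq_eq {σ s : Fin n → ℝ} (hσ : Antitone σ) (hs : Antitone s)
    (hσ0 : ∀ i, 0 ≤ σ i) (hs0 : ∀ i, 0 ≤ s i)
    (h : ∏ i, (Polynomial.X - Polynomial.C (((σ i : ℝ) : ℂ) ^ 2))
      = ∏ i, (Polynomial.X - Polynomial.C (((s i : ℝ) : ℂ) ^ 2))) : σ = s := by
  have h1 := congrArg Polynomial.roots h
  have hr : ∀ f : Fin n → ℂ, (∏ i, (Polynomial.X - Polynomial.C (f i))).roots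
      = Multiset.map f Finset.univ.val := fun f => by
    rw [← Polynomial.roots_multiset_prod_X_sub_C (Multiset.map f Finset.univ.val),
      Multiset.map_map]
    rfl
  rw [hr, hr] at h1
  have h2 := congrArg (Multiset.map fun c : ℂ => √c.re) h1
  rw [Multiset.map_map, Multiset.map_map] at h2
  have e : ∀ f : Fin n → ℝ, (∀ i, 0 ≤ f i) →
      ((fun c : ℂ => √c.re) ∘ fun i => ((f i : ℝ) : ℂ) ^ 2) = f := fun f hf => by
    funext i
    rw [Function.comp_apply, ← Complex.ofReal_pow, Complex.ofReal_re, Real.sqrt_sq (hf i)]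
  rw [e σ hσ0, e s hs0, Fin.univ_val_map, Fin.univ_val_map, Multiset.coe_eq_coe] at h2
  exact List.ofFn_injective (h2.eq_of_pairwise' hσ.sortedGE_ofFn.pairwise
    hs.sortedGE_ofFn.pairwise)

end Balancing

/-! ### The error bound -/

section Reduction

variable {n m p : ℕ}

/-- Balanced truncation obeys the twice-the-tail bound on the closed exterior of the unit disc. -/
theorem Realization.IsBalancedTruncation.error_bound {S : Realization n m p} {r : ℕ} {hr : r ≤ n}
    {R : Realization r m p} (hR : S.IsBalancedTruncation r hr R) (hS : IsSchurStable S.A)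
    {σ : Fin n → ℝ} (hσ : S.IsHankelSingularValues σ) {z : ℂ} (hz : 1 ≤ ‖z‖) :
    IsUnit (z • (1 : Matrix (Fin r) (Fin r) ℂ) - R.A).det ∧
      sigmaMax (S.transfer z - R.transfer z) ≤
        2 * ∑ i ∈ Finset.univ.filter (fun i : Fin n => r ≤ (i : ℕ)), σ i := by
  obtain ⟨P, Q, U, V, s, hP, hQ, hU, hPU, hV, hsa, hs, hVQ, rfl⟩ := hR
  obtain ⟨hσa, hσ0, P', Q', hP', hQ', hchar⟩ := hσ
  have hVV : Vᴴ * V = 1 := Matrix.mem_unitaryGroup_iff'.mp hV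
  have hVV' : V * Vᴴ = 1 := Matrix.mem_unitaryGroup_iff.mp hV
  obtain rfl : σ = s := by
    refine eq_of_prod_X_sub_C_sq_eq hσa hsa hσ0 (fun i => (hs i).le) ?_
    rw [← hchar, hP'.unique hS hP, hQ'.unique hS hQ, hPU, mul_assoc, Matrix.charpoly_mul_comm, hVQ,
      mul_assoc, Matrix.charpoly_mul_comm, mul_assoc, hVV, mul_one, Matrix.charpoly_diagonal]
  set L : Matrix (Fin n) (Fin n) ℂ := Matrix.diagonal (fun i => ((√(σ i) : ℝ) : ℂ)) with hL
  set L' : Matrix (Fin n) (Fin n) ℂ := Matrix.diagonal (fun i => ((√(σ i) : ℝ) : ℂ)⁻¹) with hL'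
  have hne : ∀ i, ((√(σ i) : ℝ) : ℂ) ≠ 0 := fun i => by
    exact_mod_cast (Real.sqrt_pos.mpr (hs i)).ne'
  have hsq : ∀ i, ((√(σ i) : ℝ) : ℂ) * ((√(σ i) : ℝ) : ℂ) = (σ i : ℂ) := fun i => by
    exact_mod_cast Real.mul_self_sqrt (hs i).le
  have hLL' : L * L' = 1 := by
    rw [hL, hL', Matrix.diagonal_mul_diagonal, ← Matrix.diagonal_one]
    exact congrArg _ (funext fun i => mul_inv_cancel₀ (hne i))
  have hLh : Lᴴ = L := by
    rw [hL, Matrix.diagonal_conjTranspose]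
    exact congrArg _ (funext fun i => Complex.conj_ofReal _)
  have hLh' : L'ᴴ = L' := by
    rw [hL', Matrix.diagonal_conjTranspose]
    refine congrArg _ (funext fun i => ?_)
    rw [Pi.star_apply, ← Complex.ofReal_inv]
    exact Complex.conj_ofReal _
  have hUU : U⁻¹ * U = 1 := Matrix.nonsing_inv_mul _ hU
  set T := L * Vᴴ * U⁻¹ with hT
  have hTT : T * (U * V * L') = 1 := by
    calc T * (U * V * L') = L * (Vᴴ * ((U⁻¹ * U) * V)) * L' := by
          rw [hT]; simp only [mul_assoc]
      _ = 1 := by rw [hUU, one_mul, hVV, mul_one, hLL']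
  have hTinv : T⁻¹ = U * V * L' := Matrix.inv_eq_right_inv hTT
  have hTu : IsUnit T.det := Matrix.isUnit_det_of_right_inverse hTT
  have hTP : T * P * Tᴴ = Matrix.diagonal fun i => ((σ i : ℝ) : ℂ) := by
    have e : Uᴴ * (U⁻¹)ᴴ = 1 := by
      rw [← Matrix.conjTranspose_mul, hUU, Matrix.conjTranspose_one]
    calc T * P * Tᴴ = L * (Vᴴ * ((U⁻¹ * U) * (Uᴴ * (U⁻¹)ᴴ) * V)) * Lᴴ := by
          rw [hT, hPU]
          simp only [Matrix.conjTranspose_mul, Matrix.conjTranspose_conjTranspose, mul_assoc]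
      _ = L * L := by rw [hUU, e, one_mul, one_mul, hVV, mul_one, hLh]
      _ = _ := by
          rw [hL, Matrix.diagonal_mul_diagonal]
          exact congrArg _ (funext hsq)
  have hTQ : (T⁻¹)ᴴ * Q * T⁻¹ = Matrix.diagonal fun i => ((σ i : ℝ) : ℂ) := by
    calc (T⁻¹)ᴴ * Q * T⁻¹ = L'ᴴ * (Vᴴ * (Uᴴ * Q * U) * V) * L' := by
          rw [hTinv]
          simp only [Matrix.conjTranspose_mul, mul_assoc]
      _ = L' * ((Vᴴ * V) * Matrix.diagonal (fun i => ((σ i : ℝ) : ℂ) ^ 2) * (Vᴴ * V)) * L' := by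
          rw [hVQ, hLh']
          simp only [mul_assoc]
      _ = _ := by
          rw [hVV, one_mul, mul_one, hL', Matrix.diagonal_mul_diagonal,
            Matrix.diagonal_mul_diagonal]
          refine congrArg _ (funext fun i => ?_)
          rw [← hsq i]
          have := hne i
          field_simp
  have hP1 := hP.changeCoords hTu
  have hQ1 := hQ.changeCoords hTu
  rw [hTP] at hP1
  rw [hTQ] at hQ1
  have := sigmaMax_transfer_sub_truncate_le (isDissipative_of_balanced hs hP1 hQ1) hs hz
    (isUnit_resolvent_changeCoords hTu (hS.isUnit_resolvent hz)) r hr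
  rwa [transfer_changeCoords S hTu] at this

end Reduction
end PFDBT

theorem theorem3p2 {n m p : ℕ} (G : PFDBT.Realization n m p) (ρ w : ℝ) (hw : 0 < w)
    (k : PFDBT.Routing) (r : ℕ) (hr : r ≤ n) (Gr : PFDBT.Realization r m p)
    (hGr : PFDBT.IsPFDBTReduction k G ρ w r hr Gr)
    (σ : Fin n → ℝ) (hσ : (k.mapped G ρ w).IsHankelSingularValues σ)
    (ω : ℝ) (hω : ω ∈ Set.Icc (-w) w) :
    IsUnit ((Complex.I * (ω : ℂ)) • (1 : Matrix (Fin n) (Fin n) ℂ) - G.A).det ∧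
    IsUnit ((Complex.I * (ω : ℂ)) • (1 : Matrix (Fin r) (Fin r) ℂ) - Gr.A).det ∧
    PFDBT.sigmaMax (G.transfer (Complex.I * (ω : ℂ)) - Gr.transfer (Complex.I * (ω : ℂ))) ≤
      2 * Real.sqrt (ρ ^ 2 + w ^ 2) *
        ∑ i ∈ Finset.univ.filter (fun i : Fin n => r ≤ (i : ℕ)), σ i := by
  obtain ⟨⟨hdef, hstab⟩, R, hR, hinv, rfl⟩ := hGr
  have hdef' := PFDBT.mapDefined_unmapped k hw R hinv
  have hback := PFDBT.mapped_unmapped k hw R hinv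
  have hκ := PFDBT.gain_pos ρ hw
  rcases PFDBT.band_dichotomy k ρ hw hω m p with h | ⟨z, hz, h⟩
  · obtain ⟨h1, e1⟩ := h G hdef
    obtain ⟨h2, e2⟩ := h (k.unmapped R ρ w) hdef'
    -- Truncation keeps the feedthrough matrix, so the error vanishes at this frequency.
    have hD : R.D = (k.mapped G ρ w).D := by
      obtain ⟨P, Q, U, V, s, -, -, -, -, -, -, -, -, rfl⟩ := hR
      rfl
    refine ⟨h1, h2, ?_⟩
    rw [e1, e2, hback, hD, sub_self, PFDBT.sigmaMax_zero]
    have := Finset.sum_nonneg fun i (_ : i ∈ Finset.univ.filter (fun i : Fin n => r ≤ (i : ℕ))) =>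
      hσ.2.1 i
    positivity
  · obtain ⟨hRu, hbound⟩ := hR.error_bound hstab hσ hz
    obtain ⟨h1, e1⟩ := h G hdef (hstab.isUnit_resolvent hz)
    obtain ⟨h2, e2⟩ := h (k.unmapped R ρ w) hdef' (by rw [hback]; exact hRu)
    refine ⟨h1, h2, ?_⟩
    rw [e1, e2, hback, ← smul_sub, PFDBT.sigmaMax_smul, Complex.norm_real,
      Real.norm_of_nonneg hκ.le, mul_comm 2, mul_assoc]
    exact mul_le_mul_of_nonneg_left hbound hκ.le
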